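/- Let $(X,d)$ be a metric space and $f_n:X\to X$ $(n\ge 0)$ maps; put $f_n^0=\mathrm{id}$, $f_n^k=f_{n+k-1}\circ\cdots\circ f_n$ and write $f_n^{-k}(S)$ for the preimage of $S$ under $f_n^k$. Let $A=(a_{ij})$ be an $N\times N$ transition matrix, that is, $N\ge2$, $a_{ij}\in\{0,1\}$, and every row and every column of $A$ has a nonzero entry. Let $$\Sigma_N^+(A)=\{(s_0,s_1,\dots): 1\le s_j\le N,\ a_{s_js_{j+1}}=1\text{ for all }j\ge0\},$$ with the metric $\hat\rho(\alpha,\beta)=\sum_{i\ge0}\hat d(a_i,b_i)2^{-i}$ for $\alpha=(a_i)$, $\beta=(b_i)$, where $\hat d(a,b)=0$ if $a=b$ and $1$ otherwise, let $\sigma_A(s_0,s_1,\dots)=(s_1,s_2,\dots)$, and let $\rho(A)=\lim_{n\to\infty}\|A^n\|^{1/n}$, where $\|B\|$ is the sum of the entries of $B$. Let $V_{i,n}$ $(1\le i\le N,\ n\ge0)$ be nonempty compact subsets of $X$ such that every $f_n$ is continuous on $E=\bigcup_{n\ge0}\bigcup_{i=1}^N V_{i,n}$, and for $\alpha=(a_0,a_1,\dots)\in\Sigma_N^+(A)$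 and $m,n\ge0$ put $V_\alpha^{m,n}=\bigcap_{k=0}^m f_n^{-k}(V_{a_k,n+k})$. Assume - (H1) $V_\alpha^{m,n}\ne\emptyset$ for all $m,n\ge0$ and all $\alpha\in\Sigma_N^+(A)$; - (H2) for every $\alpha\in\Sigma_N^+(A)$, $\operatorname{diam}V_\alpha^{m,n}\to0$ as $m\to\infty$, uniformly in $n\ge0$. Then there are nonempty compact sets $\Lambda_n\subset\bigcup_{i=1}^N V_{i,n}$ $(n\ge0)$ with $f_n(\Lambda_n)=\Lambda_{n+1}$ for all $n\ge 0$ such that $(\Sigma_N^+(A),\sigma_A)$ is topologically equi-semiconjugate to the subsystem of $(f_n)$ on $(\Lambda_n)$; that is, there are surjective maps $h_n:\Sigma_N^+(A)\to\Lambda_n$ with $h_{n+1}\circ\sigma_A=f_n\circ h_n$ for all $n\ge0$ which are equi-continuous: for every $\varepsilon>0$ there is $\delta>0$ such that $\hat\rho(\alpha,\beta)<\delta$ implies $d(h_n(\alpha),h_n(\beta))<\varepsilon$ for all $n\ge0$ and all $\alpha,\beta\in\Sigma_N^+(A)$. Moreover, if $X$ is compact, then $$h(f_{0,\infty},\Lambda_0)\le\log\rho(A).$$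 Here, for nonempty $Y\subset X$, $h(f_{0,\infty},Y)=\sup_{\mathcal A}\limsup_{n\to\infty}\frac1n\log\mathcal N(\mathcal A_0^n|_Y)$, the supremum being over all open covers $\mathcal A$ of $X$, with $\mathcal A_0^n=\{\bigcap_{j=0}^{n-1}f_0^{-j}(A_j):A_0,\dots,A_{n-1}\in\mathcal A\}$, $\mathcal A_0^n|_Y=\{B\cap Y:B\in\mathcal A_0^n\}$, and $\mathcal N(\cdot)$ the minimal cardinality of a subcover of $Y$. -/

import Mathlib

open Filter Topology

namespace NDS

/-! ### Non-autonomous discrete systems `x_{n+1} = f n (x_n)` -/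

/-- `iter f n k` is the `k`-fold composition `f_{n+k-1} ∘ ⋯ ∘ f_n`, with `iter f n 0 = id`. -/
def iter {X : Type*} (f : ℕ → X → X) (n : ℕ) : ℕ → X → X
  | 0 => id
  | k + 1 => f (n + k) ∘ iter f n k

/-- The sequence of sets `Λ` is invariant under `f`: `f_n(Λ_n) ⊆ Λ_{n+1}` for all `n`. -/
def Invariant {X : Type*} (f : ℕ → X → X) (Λ : ℕ → Set X) : Prop :=
  ∀ n, Set.MapsTo (f n) (Λ n) (Λ (n + 1))

/-- A sequence of maps `h_n : Λ_n → E_n` is equi-continuous: `δ` depends on `ε` only, neither on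
`n` nor on the points. -/
def EquiContinuous {X Y : Type*} [MetricSpace X] [MetricSpace Y] {Λ : ℕ → Set X} {E : ℕ → Set Y}
    (h : ∀ n, Λ n → E n) : Prop :=
  ∀ ε > 0, ∃ δ > 0, ∀ n, ∀ x y : Λ n, dist x y < δ → dist (h n x) (h n y) < ε

/-- The subsystem of `f` on `Λ` is topologically equi-semiconjugate to the subsystem of `g` on `E`:
both sequences of sets are invariant, and there is an equi-continuous sequence of surjective maps
`h_n : Λ_n → E_n` with `h_{n+1} ∘ f_n = g_n ∘ h_n` on `Λ_n`. -/
def EquiSemiconjugate {X Y : Type*} [MetricSpace X] [MetricSpace Y]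
    (f : ℕ → X → X) (Λ : ℕ → Set X) (g : ℕ → Y → Y) (E : ℕ → Set Y) : Prop :=
  ∃ hΛ : Invariant f Λ, Invariant g E ∧
    ∃ h : ∀ n, Λ n → E n,
      (∀ n, Function.Surjective (h n)) ∧ EquiContinuous h ∧
      ∀ n (x : Λ n), (h (n + 1) ⟨f n x, hΛ n x.2⟩ : Y) = g n (h n x)

/-! ### Topological entropy of a non-autonomous system on a subset -/

/-- The trace `{U ∩ Y : U ∈ 𝒜}` of a family of sets on `Y`. -/
def traceOn {X : Type*} (𝒜 : Set (Set X)) (Y : Set X) : Set (Set X) :=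
  {B | ∃ U ∈ 𝒜, B = U ∩ Y}

/-- The minimal cardinality of a subfamily of `𝒜` that covers `Y`. -/
noncomputable def minCard {X : Type*} (𝒜 : Set (Set X)) (Y : Set X) : ℕ∞ :=
  ⨅ (t : Set (Set X)) (_ : t ⊆ 𝒜) (_ : Y ⊆ ⋃₀ t), t.encard

/-- The family of all sets `⋂_{j<n} (f_0^j)⁻¹(A_j)` with `A_0, …, A_{n-1} ∈ 𝒜`. -/
def refineCover {X : Type*} (f : ℕ → X → X) (𝒜 : Set (Set X)) (n : ℕ) : Set (Set X) :=
  {B | ∃ U : Fin n → Set X, (∀ j, U j ∈ 𝒜) ∧ B = ⋂ j : Fin n, iter f 0 (j : ℕ) ⁻¹' U j}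

/-- Topological entropy of `f` on `Y` by open covers of the (compact) space `X`; the value may
be infinite. -/
noncomputable def entropy {X : Type*} [TopologicalSpace X] (f : ℕ → X → X) (Y : Set X) : EReal :=
  ⨆ (𝒜 : Set (Set X)) (_ : (∀ U ∈ 𝒜, IsOpen U) ∧ ⋃₀ 𝒜 = Set.univ),
    limsup (fun n : ℕ =>
      ENNReal.log ((minCard (traceOn (refineCover f 𝒜 n) Y) Y : ℕ∞) : ENNReal) / (n : EReal)) atTop

/-! ### Transition matrices and subshifts of finite type -/

/-- An `N × N` transition matrix, `N ≥ 2`: all entries are `0` or `1`, and no row and no column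
vanishes. -/
structure IsTransitionMatrix {N : ℕ} (A : Matrix (Fin N) (Fin N) ℕ) : Prop where
  two_le : 2 ≤ N
  zero_or_one : ∀ i j, A i j = 0 ∨ A i j = 1
  row : ∀ i, 1 ≤ ∑ j, A i j
  col : ∀ j, 1 ≤ ∑ i, A i j

/-- `‖A‖`, the sum of all entries. -/
noncomputable def entrySum {N : ℕ} (A : Matrix (Fin N) (Fin N) ℕ) : ℝ :=
  ∑ i, ∑ j, (A i j : ℝ)

/-- `ρ(A) = lim ‖Aⁿ‖^{1/n}`. -/
noncomputable def rho {N : ℕ} (A : Matrix (Fin N) (Fin N) ℕ) : ℝ :=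
  limUnder atTop (fun n : ℕ => entrySum (A ^ n) ^ ((1 : ℝ) / n))

theorem entrySum_mul_le {N : ℕ} (A B : Matrix (Fin N) (Fin N) ℕ) :
    entrySum (A * B) ≤ entrySum A * entrySum B := by
  have h : ∑ i, ∑ j, (A * B) i j ≤ (∑ i, ∑ j, A i j) * ∑ i, ∑ j, B i j := by
    simp only [Matrix.mul_apply]
    rw [Finset.sum_mul]
    refine Finset.sum_le_sum fun i _ => ?_
    rw [Finset.sum_comm, Finset.sum_mul]
    refine Finset.sum_le_sum fun k _ => ?_
    rw [← Finset.mul_sum]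
    exact Nat.mul_le_mul_left _
      (Finset.single_le_sum (f := fun i => ∑ j, B i j) (fun _ _ => Nat.zero_le _)
        (Finset.mem_univ k))
  unfold entrySum
  exact_mod_cast h

theorem IsTransitionMatrix.one_le_row_pow {N : ℕ} {A : Matrix (Fin N) (Fin N) ℕ}
    (hA : IsTransitionMatrix A) (n : ℕ) : ∀ i, 1 ≤ ∑ j, (A ^ n) i j := by
  induction n with
  | zero => intro i; simp [Matrix.one_apply]
  | succ n ih =>
    intro i
    rw [pow_succ]
    simp only [Matrix.mul_apply]
    rw [Finset.sum_comm]
    refine (ih i).trans (Finset.sum_le_sum fun k _ => ?_)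
    rw [← Finset.mul_sum]
    exact Nat.le_mul_of_pos_right _ (hA.row k)

theorem IsTransitionMatrix.one_le_entrySum_pow {N : ℕ} {A : Matrix (Fin N) (Fin N) ℕ}
    (hA : IsTransitionMatrix A) (n : ℕ) : 1 ≤ entrySum (A ^ n) := by
  have h : 1 ≤ ∑ i, ∑ j, (A ^ n) i j :=
    (hA.one_le_row_pow n ⟨0, by have := hA.two_le; omega⟩).trans
      (Finset.single_le_sum (f := fun i => ∑ j, (A ^ n) i j) (fun _ _ => Nat.zero_le _)
        (Finset.mem_univ _))
  unfold entrySum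
  exact_mod_cast h

/-- The limit in the definition of `ρ(A)` exists. -/
theorem IsTransitionMatrix.tendsto_rho {N : ℕ} {A : Matrix (Fin N) (Fin N) ℕ}
    (hA : IsTransitionMatrix A) :
    Tendsto (fun n : ℕ => entrySum (A ^ n) ^ ((1 : ℝ) / n)) atTop (𝓝 (rho A)) := by
  have pos : ∀ n, 0 < entrySum (A ^ n) := fun n =>
    lt_of_lt_of_le one_pos (hA.one_le_entrySum_pow n)
  have hs : Subadditive (fun n => Real.log (entrySum (A ^ n))) := by
    intro m n
    beta_reduce
    rw [← Real.log_mul (pos m).ne' (pos n).ne', pow_add]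
    refine Real.log_le_log ?_ (entrySum_mul_le _ _)
    rw [← pow_add]; exact pos _
  have hb : BddBelow (Set.range fun n : ℕ => Real.log (entrySum (A ^ n)) / n) := by
    refine ⟨0, ?_⟩
    rintro _ ⟨n, rfl⟩
    exact div_nonneg (Real.log_nonneg (hA.one_le_entrySum_pow n)) (Nat.cast_nonneg n)
  have ht := (Real.continuous_exp.tendsto _).comp (hs.tendsto_lim hb)
  have he : (fun n : ℕ => entrySum (A ^ n) ^ ((1 : ℝ) / n)) =
      Real.exp ∘ fun n : ℕ => Real.log (entrySum (A ^ n)) / n := by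
    funext n
    simp only [Function.comp]
    rw [Real.rpow_def_of_pos (pos n), mul_one_div]
  rw [← he] at ht
  exact tendsto_nhds_limUnder ⟨_, ht⟩

/-- `Σ_N⁺(A)`: the one-sided sequences `s` of symbols with `a_{s_j s_{j+1}} = 1` for all `j`
(the symbols `1, …, N` are the elements of `Fin N`). -/
def Subshift {N : ℕ} (A : Matrix (Fin N) (Fin N) ℕ) : Type :=
  {s : ℕ → Fin N // ∀ j, A (s j) (s (j + 1)) = 1}

/-- The term `d̂(a_i, b_i) / 2^i` of the metric on sequences. -/
noncomputable def symTerm {N : ℕ} (a b : ℕ → Fin N) (i : ℕ) : ℝ :=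
  (if a i = b i then 0 else 1) / 2 ^ i

theorem symTerm_nonneg {N : ℕ} (a b : ℕ → Fin N) (i : ℕ) : 0 ≤ symTerm a b i := by
  unfold symTerm; split_ifs <;> positivity

theorem summable_symTerm {N : ℕ} (a b : ℕ → Fin N) : Summable (symTerm a b) := by
  refine Summable.of_nonneg_of_le (symTerm_nonneg a b) (fun i => ?_) summable_geometric_two
  unfold symTerm
  rw [one_div, inv_pow, ← one_div]
  gcongr
  split_ifs <;> norm_num

/-- The metric `ρ̂(α, β) = ∑ d̂(a_i, b_i) / 2^i` with `d̂` the discrete metric on symbols. -/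
noncomputable instance {N : ℕ} (A : Matrix (Fin N) (Fin N) ℕ) : MetricSpace (Subshift A) where
  dist α β := ∑' i, symTerm α.1 β.1 i
  dist_self α := by simp [symTerm]
  dist_comm α β := by simp only [symTerm, eq_comm]
  dist_triangle α β γ := by
    rw [← (summable_symTerm α.1 β.1).tsum_add (summable_symTerm β.1 γ.1)]
    refine (summable_symTerm _ _).tsum_le_tsum (fun i => ?_)
      ((summable_symTerm α.1 β.1).add (summable_symTerm β.1 γ.1))
    unfold symTerm
    rw [← add_div]
    gcongr
    by_cases h1 : α.1 i = β.1 i <;> by_cases h2 : β.1 i = γ.1 i <;>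
      by_cases h3 : α.1 i = γ.1 i <;> simp_all
  eq_of_dist_eq_zero {α β} h := by
    have h0 := ((summable_symTerm α.1 β.1).hasSum_iff.2 h)
    rw [hasSum_zero_iff_of_nonneg (symTerm_nonneg _ _)] at h0
    refine Subtype.ext (funext fun i => ?_)
    have := congrFun h0 i
    by_contra hne
    simp [symTerm, hne] at this

/-- The shift map `σ_A(s_0, s_1, s_2, …) = (s_1, s_2, …)`. -/
def shift {N : ℕ} (A : Matrix (Fin N) (Fin N) ℕ) (s : Subshift A) : Subshift A :=
  ⟨fun j => s.1 (j + 1), fun j => s.2 (j + 1)⟩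

/-! ### Itinerary sets -/

/-- `V_α^{m,n} = ⋂_{k=0}^m (f_n^k)⁻¹(V_{a_k, n+k})`. -/
def itin {X : Type*} {N : ℕ} {A : Matrix (Fin N) (Fin N) ℕ} (f : ℕ → X → X)
    (V : Fin N → ℕ → Set X) (α : Subshift A) (m n : ℕ) : Set X :=
  ⋂ k ∈ Set.Iic m, iter f n k ⁻¹' V (α.1 k) (n + k)

end NDS

namespace NDS

/-! ### Time-dependent compositions. -/

section Iterates

variable {X : Type*}

/-! For fixed `α` and `n` the sets `V_α^{m,n}` are nonempty, compact and decreasing in `m`, with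
diameters tending to 0, so they meet in one point `h_n(α)`. Since `f_n(h_n(α))` lies in every
`V_{σα}^{m,n+1}`, uniqueness gives `h_{n+1} ∘ σ = f_n ∘ h_n`. Put `Λ_n = h_n(Σ)`; surjectivity of
the shift yields `f_n(Λ_n) = Λ_{n+1}`.

(H2) is uniform in `n` but not in `α`; compactness of the subshift supplies the missing uniformity,
hence equi-continuity (`exists_dist_lt_of_dist_lt`).

For the entropy, a Lebesgue number of the cover and equi-continuity give an `m`, independent of
time, such that the initial word of length `n + m + 1` selects one cover element at each time below
`n`. At most `‖A^(n+m)‖` such words occur, and this grows at rate `log ρ(A)`. -/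

theorem iter_succ_apply' (f : ℕ → X → X) (n k : ℕ) (x : X) :
    iter f n (k + 1) x = iter f (n + 1) k (f n x) := by
  induction k with
  | zero => simp [iter]
  | succ k ih =>
    have h : iter f n (k + 1 + 1) x = f (n + (k + 1)) (iter f n (k + 1) x) := rfl
    rw [h, ih, show n + (k + 1) = n + 1 + k by omega]
    rfl

end Iterates

/-! ### The subshift: surjectivity, compactness, word counts and growth rate. -/

section Symbolic

variable {N : ℕ} {A : Matrix (Fin N) (Fin N) ℕ}

theorem IsTransitionMatrix.exists_next (hA : IsTransitionMatrix A) (i : Fin N) :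
    ∃ j, A i j = 1 := by
  by_contra! h
  have h0 : ∑ j, A i j = 0 :=
    Finset.sum_eq_zero fun j _ => (hA.zero_or_one i j).resolve_right (h j)
  have := hA.row i
  omega

theorem IsTransitionMatrix.exists_prev (hA : IsTransitionMatrix A) (j : Fin N) :
    ∃ i, A i j = 1 := by
  by_contra! h
  have h0 : ∑ i, A i j = 0 :=
    Finset.sum_eq_zero fun i _ => (hA.zero_or_one i j).resolve_right (h i)
  have := hA.col j
  omega

theorem IsTransitionMatrix.nonempty_subshift (hA : IsTransitionMatrix A) :
    Nonempty (Subshift A) := by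
  choose g hg using hA.exists_next
  refine ⟨⟨fun k => g^[k] ⟨0, by have := hA.two_le; omega⟩, fun j => ?_⟩⟩
  beta_reduce
  rw [Function.iterate_succ_apply']
  exact hg _

theorem IsTransitionMatrix.shift_surjective (hA : IsTransitionMatrix A) :
    Function.Surjective (shift A) := by
  intro s
  obtain ⟨i, hi⟩ := hA.exists_prev (s.1 0)
  refine ⟨⟨fun k => Nat.casesOn k i s.1, fun j => ?_⟩, rfl⟩
  cases j with
  | zero => exact hi
  | succ j => exact s.2 j

theorem iterate_shift_apply (s : Subshift A) (k i : ℕ) :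
    ((shift A)^[k] s).1 i = s.1 (i + k) := by
  induction k generalizing s with
  | zero => rfl
  | succ k ih => rw [Function.iterate_succ_apply, ih]; rfl

theorem eq_of_dist_lt {α β : Subshift A} {m : ℕ} (h : dist α β < 1 / 2 ^ m) :
    ∀ k ≤ m, α.1 k = β.1 k := by
  intro k hk
  by_contra hne
  have h1 : symTerm α.1 β.1 k ≤ dist α β :=
    (summable_symTerm α.1 β.1).le_tsum k fun j _ => symTerm_nonneg _ _ j
  rw [symTerm, if_neg hne] at h1
  have h2 : (1 : ℝ) / 2 ^ m ≤ 1 / 2 ^ k := by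
    gcongr
    norm_num
  linarith

theorem dist_le_of_forall_eq {α β : Subshift A} {m : ℕ} (h : ∀ k ≤ m, α.1 k = β.1 k) :
    dist α β ≤ 2 * (1 / 2) ^ m := by
  have h1 : dist α β = ∑' i, symTerm α.1 β.1 i := rfl
  have hs := summable_symTerm α.1 β.1
  have h0 : ∑ i ∈ Finset.range m, symTerm α.1 β.1 i = 0 :=
    Finset.sum_eq_zero fun i hi => by
      rw [symTerm, if_pos (h i (Finset.mem_range.1 hi).le), zero_div]
  rw [h1, ← hs.sum_add_tsum_nat_add m, h0, zero_add, mul_comm,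
    show (1 / 2 : ℝ) ^ m * 2 = ∑' i : ℕ, (1 / 2) ^ m * (1 / 2) ^ i by
      rw [tsum_mul_left, tsum_geometric_two]]
  refine ((summable_nat_add_iff m).2 hs).tsum_le_tsum (fun i => ?_)
    (summable_geometric_two.mul_left _)
  rw [← pow_add, add_comm m i, one_div, inv_pow, ← one_div, symTerm]
  gcongr
  split_ifs <;> norm_num

theorem continuous_symTerm (i : ℕ) :
    Continuous fun p : (ℕ → Fin N) × (ℕ → Fin N) => symTerm p.1 p.2 i := by
  have h : Continuous fun q : Fin N × Fin N => (if q.1 = q.2 then (0 : ℝ) else 1) / 2 ^ i :=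
    continuous_of_discreteTopology
  exact h.comp (f := fun p : (ℕ → Fin N) × (ℕ → Fin N) => (p.1 i, p.2 i)) (by fun_prop)

theorem continuous_tsum_symTerm :
    Continuous fun p : (ℕ → Fin N) × (ℕ → Fin N) => ∑' i, symTerm p.1 p.2 i := by
  refine continuous_tsum continuous_symTerm summable_geometric_two fun i p => ?_
  rw [Real.norm_of_nonneg (symTerm_nonneg _ _ i), symTerm, one_div, inv_pow, ← one_div]
  gcongr
  split_ifs <;> norm_num

/-- The admissible sequences are closed in a product of finite discrete spaces. The product topology
is compared with `ρ̂` in one direction only: a continuous surjection from a compact space suffices.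
-/
instance compactSpace_subshift : CompactSpace (Subshift A) := by
  let S : Set (ℕ → Fin N) := {s | ∀ j, A (s j) (s (j + 1)) = 1}
  have hS : IsClosed S := by
    have hSe : S = ⋂ j, (fun s : ℕ → Fin N => (s j, s (j + 1))) ⁻¹' {q | A q.1 q.2 = 1} := by
      ext s; simp [S]
    rw [hSe]
    exact isClosed_iInter fun j => (isClosed_discrete _).preimage (by fun_prop)
  have : CompactSpace S := isCompact_iff_compactSpace.1 hS.isCompact
  let φ : S → Subshift A := fun s => ⟨s.1, s.2⟩
  have hφ : Continuous φ := by
    refine continuous_iff_continuousAt.2 fun s => tendsto_iff_dist_tendsto_zero.2 ?_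
    have hc : Continuous fun t : S => ∑' i, symTerm t.1 s.1 i :=
      continuous_tsum_symTerm.comp (f := fun t : S => (t.1, s.1)) (by fun_prop)
    have ht := hc.tendsto s
    have h0 : ∑' i, symTerm s.1 s.1 i = 0 := by simp [symTerm]
    rw [h0] at ht
    exact ht
  refine ⟨?_⟩
  have hr : Set.range φ = Set.univ := Set.eq_univ_of_forall fun s => ⟨⟨s.1, s.2⟩, rfl⟩
  rw [← hr]
  exact isCompact_range hφ

/-- The initial word of length `k + 1` of a sequence. -/
def initialWord (k : ℕ) (s : Subshift A) : Fin (k + 1) → Fin N := fun i => s.1 i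

/-- With the last symbol fixed at `j`, deleting it is injective and leaves a word ending in some `i`
with `A i j = 1`; this is the recursion for column sums of powers. -/
theorem ncard_initialWord_ending_le (k : ℕ) (j : Fin N) :
    (initialWord (A := A) k '' {s | s.1 k = j}).ncard ≤ ∑ i, (A ^ k) i j := by
  induction k generalizing j with
  | zero =>
    have h1 : (initialWord (A := A) 0 '' {s | s.1 0 = j}) ⊆ {fun _ => j} := by
      rintro _ ⟨s, hs, rfl⟩
      refine funext fun i => ?_
      rw [Fin.fin_one_eq_zero i]
      exact hs
    refine (Set.ncard_le_ncard h1 (Set.finite_singleton _)).trans ?_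
    simp [Matrix.one_apply]
  | succ k ih =>
    let W : Fin N → Set (Fin (k + 1) → Fin N) := fun i => initialWord (A := A) k '' {s | s.1 k = i}
    let T : Finset (Fin N) := Finset.univ.filter fun i => A i j = 1
    have hinj : Set.InjOn (Fin.init : (Fin (k + 2) → Fin N) → Fin (k + 1) → Fin N)
        (initialWord (A := A) (k + 1) '' {s | s.1 (k + 1) = j}) := by
      rintro _ ⟨s, hs, rfl⟩ _ ⟨t, ht, rfl⟩ hst
      refine funext fun i => ?_
      induction i using Fin.lastCases with
      | last => exact (show s.1 (k + 1) = j from hs).trans (show t.1 (k + 1) = j from ht).symm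
      | cast i => exact congrFun hst i
    have hsub : (Fin.init : (Fin (k + 2) → Fin N) → Fin (k + 1) → Fin N) ''
        (initialWord (A := A) (k + 1) '' {s | s.1 (k + 1) = j}) ⊆ ⋃ i ∈ T, W i := by
      rintro _ ⟨_, ⟨s, hs, rfl⟩, rfl⟩
      refine Set.mem_iUnion₂.2 ⟨s.1 k, ?_, s, rfl, rfl⟩
      have h1 : s.1 (k + 1) = j := hs
      simpa [T, h1] using s.2 k
    calc (initialWord (A := A) (k + 1) '' {s | s.1 (k + 1) = j}).ncard
        = _ := (hinj.ncard_image).symm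
      _ ≤ (⋃ i ∈ T, W i).ncard := Set.ncard_le_ncard hsub (Set.toFinite _)
      _ ≤ ∑ i ∈ T, (W i).ncard := Finset.set_ncard_biUnion_le T W
      _ ≤ ∑ i ∈ T, ∑ l, (A ^ k) l i := Finset.sum_le_sum fun i _ => ih i
      _ = ∑ i ∈ T, (∑ l, (A ^ k) l i) * A i j :=
          Finset.sum_congr rfl fun i hi => by rw [(Finset.mem_filter.1 hi).2, mul_one]
      _ ≤ ∑ i, (∑ l, (A ^ k) l i) * A i j :=
          Finset.sum_le_sum_of_subset (Finset.subset_univ _)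
      _ = ∑ l, (A ^ (k + 1)) l j := by
          simp only [pow_succ, Matrix.mul_apply, Finset.sum_mul]
          exact Finset.sum_comm

/-- The words of length `k + 1` that occur in the subshift number at most `‖A ^ k‖`. -/
theorem ncard_range_initialWord_le (k : ℕ) :
    ((Set.range (initialWord (A := A) k)).ncard : ℝ) ≤ entrySum (A ^ k) := by
  have hU : Set.range (initialWord (A := A) k) ⊆
      ⋃ j ∈ (Finset.univ : Finset (Fin N)), initialWord (A := A) k '' {s | s.1 k = j} := by
    rintro _ ⟨s, rfl⟩
    exact Set.mem_iUnion₂.2 ⟨s.1 k, Finset.mem_univ _, s, rfl, rfl⟩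
  have h : (Set.range (initialWord (A := A) k)).ncard ≤ ∑ i, ∑ j, (A ^ k) i j := by
    refine (Set.ncard_le_ncard hU (Set.toFinite _)).trans
      ((Finset.set_ncard_biUnion_le _ _).trans ?_)
    rw [Finset.sum_comm (f := fun i j => (A ^ k) i j)]
    exact Finset.sum_le_sum fun j _ => ncard_initialWord_ending_le k j
  unfold entrySum
  exact_mod_cast h

theorem IsTransitionMatrix.one_le_rho (hA : IsTransitionMatrix A) : 1 ≤ rho A :=
  ge_of_tendsto' hA.tendsto_rho fun n =>
    Real.one_le_rpow (hA.one_le_entrySum_pow n) (by positivity)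

theorem IsTransitionMatrix.tendsto_log_entrySum (hA : IsTransitionMatrix A) (m : ℕ) :
    Tendsto (fun n : ℕ => Real.log (entrySum (A ^ (n + m))) / n) atTop (𝓝 (Real.log (rho A))) := by
  have h1 : Tendsto (fun n : ℕ => Real.log (entrySum (A ^ n)) / n) atTop
      (𝓝 (Real.log (rho A))) := by
    refine (hA.tendsto_rho.log (by linarith [hA.one_le_rho])).congr fun n => ?_
    rw [Real.log_rpow (by linarith [hA.one_le_entrySum_pow n])]
    ring
  have h2 := h1.comp (tendsto_add_atTop_nat m)
  -- The factor `(n + m) / n` trades the denominator `n + m` for `n`.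
  have h3 : Tendsto (fun n : ℕ => 1 + (m : ℝ) / n) atTop (𝓝 (1 + 0)) :=
    tendsto_const_nhds.add (tendsto_const_div_atTop_nhds_zero_nat _)
  have h4 := h2.mul h3
  rw [add_zero, mul_one] at h4
  refine h4.congr' ?_
  filter_upwards [eventually_ge_atTop 1] with n hn
  have hn' : (0 : ℝ) < n := by exact_mod_cast hn
  simp only [Function.comp, Nat.cast_add]
  field_simp

end Symbolic

/-! ### The coding maps and their equi-continuity. -/

section Coding

variable {X : Type*} {f : ℕ → X → X} {N : ℕ} {A : Matrix (Fin N) (Fin N) ℕ}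
  {V : Fin N → ℕ → Set X}

theorem mem_itin {α : Subshift A} {m n : ℕ} {x : X} :
    x ∈ itin f V α m n ↔ ∀ k ≤ m, iter f n k x ∈ V (α.1 k) (n + k) := by
  simp [itin]

theorem itin_succ (α : Subshift A) (m n : ℕ) :
    itin f V α (m + 1) n =
      itin f V α m n ∩ iter f n (m + 1) ⁻¹' V (α.1 (m + 1)) (n + (m + 1)) := by
  ext x
  simp only [mem_itin, Set.mem_inter_iff, Set.mem_preimage]
  refine ⟨fun h => ⟨fun k hk => h k (by omega), h _ le_rfl⟩, fun h k hk => ?_⟩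
  rcases Nat.le_succ_iff.1 hk with hk | rfl
  exacts [h.1 k hk, h.2]

theorem apply_mem_itin_shift {α : Subshift A} {n : ℕ} {x : X} (hx : ∀ m, x ∈ itin f V α m n)
    (m : ℕ) : f n x ∈ itin f V (shift A α) m (n + 1) := by
  refine mem_itin.2 fun k hk => ?_
  rw [← iter_succ_apply', show n + 1 + k = n + (k + 1) by omega]
  exact mem_itin.1 (hx (k + 1)) (k + 1) le_rfl

variable [MetricSpace X]

/-- Each `f_n` is continuous only on `E`. The itinerary keeps the orbit in `E` through time `m`, so
one further application, `k = m + 1`, is still allowed. -/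
theorem continuousOn_iter_itin (hf : ∀ n, ContinuousOn (f n) (⋃ k, ⋃ i, V i k))
    (α : Subshift A) {m n k : ℕ} (hk : k ≤ m + 1) : ContinuousOn (iter f n k) (itin f V α m n) := by
  induction k with
  | zero => exact continuousOn_id
  | succ k ih =>
    refine (hf (n + k)).comp (ih (by omega)) fun x hx => ?_
    exact Set.mem_iUnion₂.2 ⟨_, _, mem_itin.1 hx k (by omega)⟩

theorem isCompact_itin (hVc : ∀ i n, IsCompact (V i n))
    (hf : ∀ n, ContinuousOn (f n) (⋃ k, ⋃ i, V i k)) (α : Subshift A) (m n : ℕ) :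
    IsCompact (itin f V α m n) := by
  induction m with
  | zero =>
    have h : itin f V α 0 n = V (α.1 0) n := by
      ext x
      simp [mem_itin, iter]
    rw [h]
    exact hVc _ _
  | succ m ih =>
    rw [itin_succ]
    -- The new preimage need not be closed in `X`; it is closed relative to the previous compact
    -- set.
    exact ih.of_isClosed_subset ((continuousOn_iter_itin hf α le_rfl).preimage_isClosed_of_isClosed
      ih.isClosed (hVc _ _).isClosed) Set.inter_subset_left

theorem exists_forall_mem_itin (hVc : ∀ i n, IsCompact (V i n))
    (hf : ∀ n, ContinuousOn (f n) (⋃ k, ⋃ i, V i k)) {α : Subshift A} {n : ℕ}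
    (H1 : ∀ m, (itin f V α m n).Nonempty) : ∃ x, ∀ m, x ∈ itin f V α m n := by
  obtain ⟨x, hx⟩ := IsCompact.nonempty_iInter_of_sequence_nonempty_isCompact_isClosed
    (fun m => itin f V α m n) (fun m => by rw [itin_succ]; exact Set.inter_subset_left) H1
    (isCompact_itin hVc hf α 0 n) (fun m => (isCompact_itin hVc hf α m n).isClosed)
  exact ⟨x, Set.mem_iInter.1 hx⟩

theorem eq_of_forall_mem_itin (hVc : ∀ i n, IsCompact (V i n))
    (hf : ∀ n, ContinuousOn (f n) (⋃ k, ⋃ i, V i k)) {α : Subshift A}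
    (H2 : TendstoUniformly (fun m n : ℕ => Metric.diam (itin f V α m n)) (fun _ => 0) atTop)
    {n : ℕ} {x y : X} (hx : ∀ m, x ∈ itin f V α m n) (hy : ∀ m, y ∈ itin f V α m n) : x = y :=
  dist_le_zero.1 <| ge_of_tendsto' (H2.tendsto_at n) fun m =>
    Metric.dist_le_diam_of_mem (isCompact_itin hVc hf α m n).isBounded (hx m) (hy m)

/-- Points coded by sequences which agree sufficiently long are close, uniformly in time. -/
theorem exists_dist_lt_of_dist_lt (hVc : ∀ i n, IsCompact (V i n))
    (hf : ∀ n, ContinuousOn (f n) (⋃ k, ⋃ i, V i k))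
    (H2 : ∀ α : Subshift A,
      TendstoUniformly (fun m n : ℕ => Metric.diam (itin f V α m n)) (fun _ => 0) atTop)
    {h : ℕ → Subshift A → X} (hh : ∀ n α m, h n α ∈ itin f V α m n) {ε : ℝ} (hε : 0 < ε) :
    ∃ δ > 0, ∀ n, ∀ α β : Subshift A, dist α β < δ → dist (h n α) (h n β) < ε := by
  have hm : ∀ α : Subshift A, ∃ m, ∀ n, Metric.diam (itin f V α m n) < ε := fun α => by
    obtain ⟨m, hm⟩ := (Metric.tendstoUniformly_iff.1 (H2 α) ε hε).exists
    refine ⟨m, fun n => ?_⟩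
    have := hm n
    rw [dist_comm, Real.dist_0_eq_abs] at this
    exact (le_abs_self _).trans_lt this
  choose m hm using hm
  -- Sequences in the ball about `α` share its symbols up to `m α`; a Lebesgue number of these balls
  -- is a `δ` independent of `α`.
  obtain ⟨δ, hδ, hL⟩ := lebesgue_number_lemma_of_metric (s := (Set.univ : Set (Subshift A)))
    (c := fun α : Subshift A => Metric.ball α (1 / 2 ^ m α)) isCompact_univ
    (fun α => Metric.isOpen_ball)
    (fun α _ => Set.mem_iUnion.2 ⟨α, Metric.mem_ball_self (by positivity)⟩)
  refine ⟨δ, hδ, fun n α β hαβ => ?_⟩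
  obtain ⟨γ, hγ⟩ := hL α (Set.mem_univ _)
  -- Both points fall into one itinerary set of the center `γ`, whose diameter is below `ε`.
  have key : ∀ β ∈ Metric.ball α δ, h n β ∈ itin f V γ (m γ) n := fun β hβ => by
    refine mem_itin.2 fun k hk => ?_
    rw [← eq_of_dist_lt (Metric.mem_ball.1 (hγ hβ)) k hk]
    exact mem_itin.1 (hh n β (m γ)) k hk
  exact (Metric.dist_le_diam_of_mem (isCompact_itin hVc hf γ _ n).isBounded
    (key α (Metric.mem_ball_self hδ))
    (key β (by rwa [Metric.mem_ball, dist_comm]))).trans_lt (hm γ n)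

end Coding

/-! ### Entropy bound by counting words. -/

section Entropy

variable {X : Type*} {N : ℕ} {A : Matrix (Fin N) (Fin N) ℕ}

theorem minCard_le_encard {𝒜 t : Set (Set X)} {Y : Set X} (h𝒜 : t ⊆ 𝒜) (hY : Y ⊆ ⋃₀ t) :
    minCard 𝒜 Y ≤ t.encard :=
  iInf₂_le_of_le t h𝒜 (iInf_le _ hY)

theorem iter_zero_coding {f : ℕ → X → X} {h : ℕ → Subshift A → X}
    (hc : ∀ n α, h (n + 1) (shift A α) = f n (h n α)) (α : Subshift A) (j : ℕ) :
    iter f 0 j (h 0 α) = h j ((shift A)^[j] α) := by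
  induction j with
  | zero => rfl
  | succ j ih =>
    rw [Function.iterate_succ_apply', hc, ← ih]
    simp [iter]

/-- Two sequences whose first `n + m + 1` symbols agree have `δ`-close orbits up to time `n`; so
the words of that length provide a subcover. -/
theorem minCard_refineCover_le [MetricSpace X] {f : ℕ → X → X} {h : ℕ → Subshift A → X}
    (hc : ∀ n α, h (n + 1) (shift A α) = f n (h n α)) {𝒜 : Set (Set X)} {δ : ℝ} {m : ℕ}
    (hδ : ∀ x, ∃ U ∈ 𝒜, Metric.ball x δ ⊆ U)
    (hm : ∀ n, ∀ α β : Subshift A, (∀ k ≤ m, α.1 k = β.1 k) → dist (h n α) (h n β) < δ) (n : ℕ) :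
    minCard (traceOn (refineCover f 𝒜 n) (Set.range (h 0))) (Set.range (h 0)) ≤
      (Set.range (initialWord (A := A) (n + m))).encard := by
  choose U hU𝒜 hU using hδ
  let c : Subshift A → Set X := fun α =>
    (⋂ j : Fin n, iter f 0 (j : ℕ) ⁻¹' U (h j ((shift A)^[j] α))) ∩ Set.range (h 0)
  -- One representative sequence per word; its orbit selects the cover elements for all points with
  -- that word.
  choose r hr using fun w : Set.range (initialWord (A := A) (n + m)) => w.2
  refine (minCard_le_encard (t := Set.range fun w => c (r w)) ?_ ?_).trans ?_
  · rintro _ ⟨w, rfl⟩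
    exact ⟨_, ⟨_, fun j => hU𝒜 _, rfl⟩, rfl⟩
  · rintro _ ⟨β, rfl⟩
    let w : Set.range (initialWord (A := A) (n + m)) := ⟨_, β, rfl⟩
    refine ⟨c (r w), ⟨w, rfl⟩, Set.mem_iInter.2 fun j => hU _ ?_, β, rfl⟩
    rw [iter_zero_coding hc]
    refine Metric.mem_ball.2 (hm j _ _ fun k hk => ?_)
    rw [iterate_shift_apply, iterate_shift_apply]
    have hj := j.2
    -- With `j < n` and `k ≤ m`, the index `k + j` stays inside the word.
    exact (congrFun (hr w) ⟨k + j, by omega⟩).symm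
  · rw [← Set.image_univ]
    refine (Set.encard_image_le _ _).trans ?_
    rw [Set.encard_univ, ENat.card_coe_set_eq]

/-- A system coded by a subshift of finite type with uniform modulus of continuity has entropy at
most the logarithm of the spectral radius. -/
theorem entropy_range_coding_le [MetricSpace X] [CompactSpace X] (hA : IsTransitionMatrix A)
    {f : ℕ → X → X} {h : ℕ → Subshift A → X}
    (hc : ∀ n α, h (n + 1) (shift A α) = f n (h n α))
    (he : ∀ ε > 0, ∃ m : ℕ, ∀ n, ∀ α β : Subshift A,
      (∀ k ≤ m, α.1 k = β.1 k) → dist (h n α) (h n β) < ε) :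
    entropy f (Set.range (h 0)) ≤ ((Real.log (rho A) : ℝ) : EReal) := by
  refine iSup₂_le fun 𝒜 h𝒜 => ?_
  obtain ⟨δ, hδ, hL⟩ := lebesgue_number_lemma_of_metric_sUnion isCompact_univ h𝒜.1 h𝒜.2.ge
  obtain ⟨m, hm⟩ := he δ hδ
  have hlim : Tendsto (fun n : ℕ => ((Real.log (entrySum (A ^ (n + m))) / n : ℝ) : EReal)) atTop
      (𝓝 ((Real.log (rho A) : ℝ) : EReal)) :=
    (continuous_coe_real_ereal.tendsto _).comp (hA.tendsto_log_entrySum m)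
  rw [← hlim.limsup_eq]
  refine limsup_le_limsup (Eventually.of_forall fun n => ?_)
  have hle := minCard_refineCover_le hc (fun x => hL x (Set.mem_univ x)) hm n
  rw [← (Set.toFinite (Set.range (initialWord (A := A) (n + m)))).cast_ncard_eq] at hle
  have hle' : ((minCard (traceOn (refineCover f 𝒜 n) (Set.range (h 0))) (Set.range (h 0)) : ℕ∞) :
      ENNReal) ≤ ENNReal.ofReal (entrySum (A ^ (n + m))) := by
    refine (ENat.toENNReal_le.2 hle).trans ?_
    rw [ENat.toENNReal_coe, ← ENNReal.ofReal_natCast]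
    exact ENNReal.ofReal_le_ofReal (ncard_range_initialWord_le _)
  have hpos : 0 < entrySum (A ^ (n + m)) := one_pos.trans_le (hA.one_le_entrySum_pow _)
  have hlog := ENNReal.log_monotone hle'
  rw [ENNReal.log_ofReal_of_pos hpos] at hlog
  beta_reduce
  rw [EReal.coe_div]
  exact EReal.div_le_div_right_of_nonneg (by positivity) hlog

end Entropy

end NDS

theorem theorem3p5 {X : Type*} [MetricSpace X] (f : ℕ → X → X)
    {N : ℕ} (A : Matrix (Fin N) (Fin N) ℕ) (hA : NDS.IsTransitionMatrix A)
    (V : Fin N → ℕ → Set X)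
    (hVne : ∀ i n, (V i n).Nonempty)
    (hVc : ∀ i n, IsCompact (V i n))
    (hf : ∀ n, ContinuousOn (f n) (⋃ k, ⋃ i, V i k))
    (H1 : ∀ (m n : ℕ) (α : NDS.Subshift A), (NDS.itin f V α m n).Nonempty)
    (H2 : ∀ α : NDS.Subshift A,
      TendstoUniformly (fun m n : ℕ => Metric.diam (NDS.itin f V α m n)) (fun _ => 0) atTop) :
    ∃ Λ : ℕ → Set X,
      (∀ n, (Λ n).Nonempty ∧ IsCompact (Λ n) ∧ Λ n ⊆ ⋃ i, V i n) ∧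
      (∀ n, f n '' Λ n = Λ (n + 1)) ∧
      NDS.EquiSemiconjugate (fun _ => NDS.shift A) (fun _ => Set.univ) f Λ ∧
      (CompactSpace X → NDS.entropy f (Λ 0) ≤ ((Real.log (NDS.rho A) : ℝ) : EReal)) := by
  have := hA.nonempty_subshift
  choose h hh using fun (n : ℕ) (α : NDS.Subshift A) =>
    NDS.exists_forall_mem_itin hVc hf (fun m => H1 m n α)
  have hc : ∀ n α, h (n + 1) (NDS.shift A α) = f n (h n α) := fun n α =>
    NDS.eq_of_forall_mem_itin hVc hf (H2 _) (hh _ _) (NDS.apply_mem_itin_shift (hh n α))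
  have he := fun (ε : ℝ) (hε : 0 < ε) => NDS.exists_dist_lt_of_dist_lt hVc hf H2 hh hε
  have hcont : ∀ n, Continuous (h n) := fun n => Metric.continuous_iff.2 fun β ε hε => by
    obtain ⟨δ, hδ, H⟩ := he ε hε
    exact ⟨δ, hδ, fun α => H n α β⟩
  refine ⟨fun n => Set.range (h n), fun n => ⟨Set.range_nonempty _, isCompact_range (hcont n), ?_⟩,
    fun n => ?_, ⟨fun n x _ => Set.mem_univ _, ?_, fun n x => ⟨h n x, x, rfl⟩, ?_, ?_, ?_⟩,
    fun _ => NDS.entropy_range_coding_le hA hc fun ε hε => ?_⟩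
  · rintro _ ⟨α, rfl⟩
    exact Set.mem_iUnion.2 ⟨α.1 0, NDS.mem_itin.1 (hh n α 0) 0 le_rfl⟩
  · beta_reduce
    rw [← Set.range_comp, ← hA.shift_surjective.range_comp (h (n + 1))]
    exact congrArg Set.range (funext fun α => (hc n α).symm)
  · rintro n _ ⟨α, rfl⟩
    exact ⟨NDS.shift A α, hc n α⟩
  · rintro n ⟨_, α, rfl⟩
    exact ⟨⟨α, Set.mem_univ _⟩, rfl⟩
  · intro ε hε
    obtain ⟨δ, hδ, H⟩ := he ε hε
    exact ⟨δ, hδ, fun n x y hxy => H n x y hxy⟩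
  · exact fun n x => hc n x
  · obtain ⟨δ, hδ, H⟩ := he ε hε
    -- Agreement through index `m` bounds the distance by `2 * (1/2)^m`, hence the target `δ / 2`.
    obtain ⟨m, hm⟩ := exists_pow_lt_of_lt_one (half_pos hδ) (one_half_lt_one (α := ℝ))
    exact ⟨m, fun n α β hαβ => H n α β ((NDS.dist_le_of_forall_eq hαβ).trans_lt (by linarith))⟩
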